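/- Formulas are built from propositional variables $p_0,p_1,\dots$ and $\bot$ by $\to$, $\Box$, $\Box^+$. A sequent is an expression $\Sigma;\Gamma\Rightarrow\Delta$, where $\Sigma$ is a set of formulas and $\Gamma,\Delta$ are finite multisets of formulas. The calculus $\mathsf S$ has the initial sequents $\Sigma;\Gamma,p\Rightarrow p,\Delta$ ($p$ a variable) and $\Sigma;\Gamma,\bot\Rightarrow\Delta$ and the following rules: - $(\to_L)$: from $\Sigma;\Gamma,B\Rightarrow\Delta$ and $\Sigma;\Gamma\Rightarrow A,\Delta$ infer $\Sigma;\Gamma,A\to B\Rightarrow\Delta$; - $(\to_R)$: from $\Sigma;\Gamma,A\Rightarrow B,\Delta$ infer $\Sigma;\Gamma\Rightarrow A\to B,\Delta$; - $(\Box)$: from $\Sigma;\Sigma_0,\Lambda,\Pi,\Box^+\Pi\Rightarrow A$ infer $\Sigma;\Phi,\Box\Lambda,\Box^+\Pi\Rightarrow\Box A,\Psi$; - $(\Box^+)$: from $\Sigma;\Sigma_0,\Lambda,\Pi,\Box^+\Pi\Rightarrow A$ (left premise) and $\Sigma;\Sigma_0,\Lambda,\Pi,\Box^+\Pi\Rightarrow\Box^+A$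 (right premise) infer $\Sigma;\Phi,\Box\Lambda,\Box^+\Pi\Rightarrow\Box^+A,\Psi$; here $\Sigma_0$ is a finite subset of $\Sigma$, and $\Phi,\Psi,\Lambda,\Pi$ are finite multisets of formulas. $\mathsf S+\mathsf{cut}$ adds the rule $(\mathsf{cut})$: from $\Sigma;\Gamma\Rightarrow A,\Delta$ and $\Sigma;\Gamma,A\Rightarrow\Delta$ infer $\Sigma;\Gamma\Rightarrow\Delta$. An $\infty$-proof is a possibly infinite tree of sequents constructed according to the rules of $\mathsf S+\mathsf{cut}$, in which every leaf is an initial sequent and every infinite branch has a tail such that (a) all applications of $(\Box^+)$ in the tail have the same principal formula $\Box^+A$; (b) the tail passes through the right premise of $(\Box^+)$ infinitely many times; (c) the tail never passes through the left premise of $(\Box^+)$; (d) $(\Box)$ is not applied in the tail. An $\infty$-proof is cut-free if $(\mathsf{cut})$ is not applied in it, and regular if it has only finitely many non-isomorphic subtrees. One writes $\mathsf S+\mathsf{cut}\vdash\Sigma;\Gamma\Rightarrow\Delta$ if some $\infty$-proof has the root $\Sigma;\Gamma\Rightarrow\Delta$. Proposition. If $\mathsf S+\mathsf{cut}\vdash\Sigma;\Gamma\Rightarrow\Delta$,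 where $\Sigma$ is finite, then there is a regular cut-free $\infty$-proof of $\Sigma;\Gamma\Rightarrow\Delta$. -/

import Mathlib

namespace KPlus

/-- Formulas of the modal logic of transitive closure: variables, falsum, implication and the two
modalities `□` (`box`) and `□⁺` (`boxPlus`). -/
inductive Formula : Type
  | var (n : ℕ) : Formula
  | bot : Formula
  | imp (A B : Formula) : Formula
  | box (A : Formula) : Formula
  | boxPlus (A : Formula) : Formula

open Formula

/-- A sequent `ctx ; left ⇒ right`: an arbitrary set of formulas and two finite multisets. -/
structure Sequent : Type where
  ctx : Set Formula
  left : Multiset Formula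
  right : Multiset Formula

/-- Names of the initial sequents and of the rules, with the principal (or cut) formula described
by the arguments: `impL A B` and `impR A B` introduce `A → B`, `box A` introduces `□ A`,
`boxPlus A` introduces `□⁺ A`, and `cut A` has cut formula `A`. -/
inductive Rule : Type
  | ax (p : ℕ) : Rule
  | botL : Rule
  | impL (A B : Formula) : Rule
  | impR (A B : Formula) : Rule
  | box (A : Formula) : Rule
  | boxPlus (A : Formula) : Rule
  | cut (A : Formula) : Rule

/-- `Infer r s l`: the sequent `s` is obtained by an application of the rule `r` of `S + cut` from
the list of premises `l`, the left premise coming first. In the modal rules `S₀` is a finite subset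
of the context, `L` and `P` give the side formulas `□ L` and `□⁺ P`, and `F`, `D` are the
remaining formulas of the conclusion. -/
inductive Infer : Rule → Sequent → List Sequent → Prop
  | ax (S : Set Formula) (G D : Multiset Formula) (p : ℕ) :
      Infer (Rule.ax p) ⟨S, var p ::ₘ G, var p ::ₘ D⟩ []
  | botL (S : Set Formula) (G D : Multiset Formula) :
      Infer Rule.botL ⟨S, bot ::ₘ G, D⟩ []
  | impL (S : Set Formula) (G D : Multiset Formula) (A B : Formula) :
      Infer (Rule.impL A B) ⟨S, imp A B ::ₘ G, D⟩ [⟨S, B ::ₘ G, D⟩, ⟨S, G, A ::ₘ D⟩]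
  | impR (S : Set Formula) (G D : Multiset Formula) (A B : Formula) :
      Infer (Rule.impR A B) ⟨S, G, imp A B ::ₘ D⟩ [⟨S, A ::ₘ G, B ::ₘ D⟩]
  | box (S : Set Formula) (S₀ : Finset Formula) (hS₀ : (S₀ : Set Formula) ⊆ S)
      (F L P D : Multiset Formula) (A : Formula) :
      Infer (Rule.box A)
        ⟨S, F + L.map Formula.box + P.map Formula.boxPlus, Formula.box A ::ₘ D⟩
        [⟨S, S₀.val + L + P + P.map Formula.boxPlus, {A}⟩]
  | boxPlus (S : Set Formula) (S₀ : Finset Formula) (hS₀ : (S₀ : Set Formula) ⊆ S)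
      (F L P D : Multiset Formula) (A : Formula) :
      Infer (Rule.boxPlus A)
        ⟨S, F + L.map Formula.box + P.map Formula.boxPlus, Formula.boxPlus A ::ₘ D⟩
        [⟨S, S₀.val + L + P + P.map Formula.boxPlus, {A}⟩,
         ⟨S, S₀.val + L + P + P.map Formula.boxPlus, {Formula.boxPlus A}⟩]
  | cut (S : Set Formula) (G D : Multiset Formula) (A : Formula) :
      Infer (Rule.cut A) ⟨S, G, D⟩ [⟨S, G, A ::ₘ D⟩, ⟨S, A ::ₘ G, D⟩]

/-- The address of the `n`-th node of the branch that turns to premise number `b k` at step `k`. -/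
def branchNode (b : ℕ → ℕ) (n : ℕ) : List ℕ := (List.range n).map b

/-- An `∞`-proof of `S + cut`: a possibly infinite tree, given by its nodes' addresses (`[]` is the
root and `a ++ [i]` is premise number `i` of the node `a`, premises being numbered from `0`);
`label a` is the sequent at the node `a` together with the rule applied there, and it is `none` if
the tree has no node `a`. Leaves are the nodes with an empty list of premises, so they are marked
by initial sequents. -/
structure InfProof : Type where
  label : List ℕ → Option (Sequent × Rule)
  root_isSome : (label []).isSome
  label_none : ∀ (a : List ℕ) (i : ℕ), label a = none → label (a ++ [i]) = none
  infer : ∀ (a : List ℕ) (s : Sequent) (r : Rule), label a = some (s, r) →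
    ∃ l : List Sequent, Infer r s l ∧ ∀ i : ℕ, (label (a ++ [i])).map Prod.fst = l[i]?
  /-- Every infinite branch has a tail, starting at its node number `N`, in which every application
  of the `□⁺` rule has the same principal formula `□⁺ A` and is passed through the right premise,
  this happens infinitely often, and the `□` rule is not applied. -/
  infinite_branch : ∀ b : ℕ → ℕ, (∀ n, (label (branchNode b n)).isSome) →
    ∃ (N : ℕ) (A : Formula),
      (∀ n, N ≤ n → ∀ (s : Sequent) (B : Formula),
        label (branchNode b n) = some (s, Rule.boxPlus B) → B = A ∧ b n = 1) ∧
      (∀ m, ∃ n, m ≤ n ∧ b n = 1 ∧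
        ∃ (s : Sequent) (B : Formula), label (branchNode b n) = some (s, Rule.boxPlus B)) ∧
      (∀ n, N ≤ n → ∀ (s : Sequent) (B : Formula),
        label (branchNode b n) ≠ some (s, Rule.box B))

namespace InfProof

/-- The root of the `∞`-proof is marked by the sequent `s`. -/
def Proves (π : InfProof) (s : Sequent) : Prop := ∃ r : Rule, π.label [] = some (s, r)

/-- There are no applications of the cut rule. -/
def CutFree (π : InfProof) : Prop :=
  ∀ (a : List ℕ) (s : Sequent) (A : Formula), π.label a ≠ some (s, Rule.cut A)

/-- The subtree rooted at `a`, with addresses taken relative to `a`; two subtrees are isomorphic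
exactly when these functions are equal. -/
def subtree (π : InfProof) (a : List ℕ) : List ℕ → Option (Sequent × Rule) :=
  fun c => π.label (a ++ c)

/-- There are only finitely many non-isomorphic subtrees. -/
def Regular (π : InfProof) : Prop :=
  {t | ∃ a : List ℕ, (π.label a).isSome ∧ π.subtree a = t}.Finite

end InfProof

/-- Provability in `S + cut`. -/
def ProvableWithCut (s : Sequent) : Prop := ∃ π : InfProof, π.Proves s

end KPlus

namespace KPlus

open Formula

/-! ### Kripke semantics and soundness -/

/-! The argument goes through Kripke semantics, with `□⁺` read as the transitive closure of
accessibility; cuts are not eliminated syntactically.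

Soundness, with cut: a refuted conclusion has a refuted premise, so a refuted root yields an
infinite branch of refuted sequents. On its tail the distance from the current world to a failure of
the principal formula `A` never grows, and it drops at each of the infinitely many right premises of
`□⁺ A`, which is impossible (`InfProof.sound`).

Completeness, cut-free: the search is confined to finitely many sequents. For a set `P` of sequents
already proved, `focused P A` is a greatest fixed point: branches either leave into `P` or go on
forever respecting the tail condition for `A`. Iterating over all foci from the empty set gives the
increasing `stage`s, which stabilise at a set `P`. The nesting mirrors the branch condition:
finitely many changes of stage, then one focus forever. Membership in a stage unravels to a cut-free
tree over finitely many states, hence a regular one (`SearchSpace.exists_regular`). The saturated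
sequents outside the limit `P` form a countermodel (`IsFixed.truth`), so a valid sequent of the
search space lies in `P` (`IsFixed.complete`). -/

/-- Truth of a formula at a world of a Kripke model, `□⁺` being interpreted by the transitive
closure of the accessibility relation. -/
def Sat {W : Type*} (R : W → W → Prop) (V : W → ℕ → Prop) : Formula → W → Prop
  | var p, w => V w p
  | bot, _ => False
  | imp A B, w => Sat R V A w → Sat R V B w
  | Formula.box A, w => ∀ v, R w v → Sat R V A v
  | Formula.boxPlus A, w => ∀ v, Relation.TransGen R w v → Sat R V A v

/-- The world `w` makes the left side of the sequent true and its right side false. -/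
def Refutes {W : Type*} (R : W → W → Prop) (V : W → ℕ → Prop) (w : W) (s : Sequent) : Prop :=
  (∀ F ∈ s.left, Sat R V F w) ∧ ∀ F ∈ s.right, ¬ Sat R V F w

/-- Some path with `n + 1` steps leads from `w` to a world where `A` is false. -/
def FailsAt {W : Type*} (R : W → W → Prop) (V : W → ℕ → Prop) (A : Formula) : ℕ → W → Prop
  | 0, w => ∃ v, R w v ∧ ¬ Sat R V A v
  | n + 1, w => ∃ v, R w v ∧ FailsAt R V A n v

/-- The length of a shortest path, less one, from `w` to a world where `A` is false. -/
noncomputable def failDist {W : Type*} (R : W → W → Prop) (V : W → ℕ → Prop) (A : Formula)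
    (w : W) : ℕ :=
  sInf {n | FailsAt R V A n w}

section Soundness

variable {W : Type*} {R : W → W → Prop} {V : W → ℕ → Prop}

theorem exists_failsAt {A : Formula} {w : W} (h : ¬ Sat R V (Formula.boxPlus A) w) :
    ∃ n, FailsAt R V A n w := by
  simp only [Sat, not_forall] at h
  obtain ⟨v, hv, hA⟩ := h
  induction hv using Relation.TransGen.head_induction_on with
  | single h => exact ⟨0, v, h, hA⟩
  | head h _ ih => exact ih.imp' Nat.succ fun n hn => ⟨_, h, hn⟩

theorem FailsAt.not_sat {A : Formula} : ∀ {n : ℕ} {w : W}, FailsAt R V A n w →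
    ¬ Sat R V (Formula.boxPlus A) w
  | 0, _, ⟨v, hv, hA⟩ => fun h => hA (h v (.single hv))
  | _ + 1, _, ⟨_, hv, hA⟩ => fun h => hA.not_sat fun u hu => h u (.head hv hu)

/-- A world where `□⁺ A` is false sees a world where `A` is false, or one where `□⁺ A` is false
that is closer to a failure of `A`. -/
theorem exists_closer {A : Formula} {w : W} (h : ¬ Sat R V (Formula.boxPlus A) w) :
    (∃ v, R w v ∧ ¬ Sat R V A v) ∨
      ∃ v, R w v ∧ ¬ Sat R V (Formula.boxPlus A) v ∧ failDist R V A v < failDist R V A w := by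
  have hmem : FailsAt R V A (failDist R V A w) w := Nat.sInf_mem (exists_failsAt h)
  generalize failDist R V A w = d at hmem
  cases d with
  | zero => exact .inl hmem
  | succ m =>
    obtain ⟨v, hv, hm⟩ := hmem
    exact .inr ⟨v, hv, hm.not_sat, Nat.lt_succ_of_le (Nat.sInf_le hm)⟩

/-- Truth of `□⁺ B` at `w` splits at a successor into `B` and `□⁺ B`, which is why the premise
contains both. Formulas of `S₀` are covered by the assumption on the context. -/
theorem sat_modal_premise {S : Set Formula} (hS : ∀ w v, R w v → ∀ F ∈ S, Sat R V F v)
    {S₀ : Finset Formula} (hS₀ : (S₀ : Set Formula) ⊆ S) {F L P : Multiset Formula} {w v : W}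
    (hw : ∀ B ∈ F + L.map Formula.box + P.map Formula.boxPlus, Sat R V B w) (hv : R w v) :
    ∀ B ∈ S₀.val + L + P + P.map Formula.boxPlus, Sat R V B v := by
  intro B hB
  simp only [Multiset.mem_add, Multiset.mem_map, Finset.mem_val] at hB hw
  rcases hB with ((hB | hB) | hB) | ⟨B, hB, rfl⟩
  · exact hS w v hv B (hS₀ hB)
  · exact hw _ (.inl (.inr ⟨B, hB, rfl⟩)) v hv
  · exact hw _ (.inr ⟨B, hB, rfl⟩) v (.single hv)
  · exact fun u hu => hw _ (.inr ⟨B, hB, rfl⟩) u (.head hv hu)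

/-- A refuted conclusion has a refuted premise; the world moves only along the modal rules, and
passing through the right premise of `□⁺` brings it closer to a failure of the principal formula. -/
theorem Infer.exists_refuted {r : Rule} {s : Sequent} {l : List Sequent} (h : Infer r s l)
    (hS : ∀ w v, R w v → ∀ F ∈ s.ctx, Sat R V F v) {w : W} (hw : Refutes R V w s) :
    ∃ i s' v, l[i]? = some s' ∧ s'.ctx = s.ctx ∧ Refutes R V v s' ∧
      ((∃ A, r = Rule.box A) ∨
        (∃ A, r = Rule.boxPlus A ∧ (i = 1 → failDist R V A v < failDist R V A w)) ∨
        v = w ∧ ∀ A, r ≠ Rule.boxPlus A) := by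
  obtain ⟨hl, hr⟩ := hw
  cases h with
  | ax S G D p => exact absurd (hl (var p) (by simp)) (hr _ (by simp))
  | botL S G D => exact (hl bot (by simp)).elim
  | impL S G D A B =>
    simp only [Multiset.mem_cons, forall_eq_or_imp] at hl
    by_cases hA : Sat R V A w
    · exact ⟨0, _, w, rfl, rfl, ⟨by simpa using ⟨hl.1 hA, hl.2⟩, hr⟩, by simp⟩
    · exact ⟨1, _, w, rfl, rfl, ⟨hl.2, by simpa using ⟨hA, hr⟩⟩, by simp⟩
  | impR S G D A B =>
    simp only [Multiset.mem_cons, forall_eq_or_imp, Sat, Classical.not_imp] at hr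
    exact ⟨0, _, w, rfl, rfl, ⟨by simpa using ⟨hr.1.1, hl⟩, by simpa using ⟨hr.1.2, hr.2⟩⟩,
      by simp⟩
  | box S S₀ hS₀ F L P D A =>
    have := hr (Formula.box A) (by simp)
    simp only [Sat, not_forall] at this
    obtain ⟨v, hv, hA⟩ := this
    exact ⟨0, _, v, rfl, rfl, ⟨sat_modal_premise hS hS₀ hl hv, by simpa using hA⟩,
      .inl ⟨A, rfl⟩⟩
  | boxPlus S S₀ hS₀ F L P D A =>
    rcases exists_closer (hr (Formula.boxPlus A) (by simp)) with ⟨v, hv, hA⟩ | ⟨v, hv, hA, hd⟩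
    · exact ⟨0, _, v, rfl, rfl, ⟨sat_modal_premise hS hS₀ hl hv, by simpa using hA⟩,
        .inr (.inl ⟨A, rfl, by simp⟩)⟩
    · exact ⟨1, _, v, rfl, rfl, ⟨sat_modal_premise hS hS₀ hl hv, by simpa using hA⟩,
        .inr (.inl ⟨A, rfl, fun _ => hd⟩)⟩
  | cut S G D A =>
    by_cases hA : Sat R V A w
    · exact ⟨1, _, w, rfl, rfl, ⟨by simpa using ⟨hA, hl⟩, hr⟩, by simp⟩
    · exact ⟨0, _, w, rfl, rfl, ⟨hl, by simpa using ⟨hA, hr⟩⟩, by simp⟩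

theorem branchNode_succ (b : ℕ → ℕ) (n : ℕ) : branchNode b (n + 1) = branchNode b n ++ [b n] := by
  simp [branchNode, List.range_succ]

theorem not_forall_frequently_lt (f : ℕ → ℕ) (N : ℕ) (hf : ∀ n, N ≤ n → f (n + 1) ≤ f n)
    (h : ∀ m, ∃ n, m ≤ n ∧ f (n + 1) < f n) : False := by
  have key : ∀ k, ∃ n, N ≤ n ∧ f n + k ≤ f N := by
    intro k
    induction k with
    | zero => exact ⟨N, le_rfl, le_rfl⟩
    | succ k ih =>
      obtain ⟨n, hn, hk⟩ := ih
      obtain ⟨m, hm, hlt⟩ := h n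
      have : f m ≤ f n := Nat.le_induction le_rfl
        (fun j hj hle => (hf j (hn.trans hj)).trans hle) m hm
      exact ⟨m + 1, by omega, by omega⟩
  obtain ⟨n, -, hn⟩ := key (f N + 1)
  omega

/-- Soundness: no world refutes the root of an `∞`-proof if the context holds at all successors. -/
theorem InfProof.sound (π : InfProof) {s : Sequent} (hπ : π.Proves s)
    (hS : ∀ w v, R w v → ∀ F ∈ s.ctx, Sat R V F v) (w : W) : ¬ Refutes R V w s := by
  intro hw
  obtain ⟨r₀, hr₀⟩ := hπ
  -- Nodes are paired with a world refuting their sequent; iterating a chosen step through such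
  -- pairs traces an infinite branch.
  let Good : List ℕ × W → Prop := fun x => ∃ t r, π.label x.1 = some (t, r) ∧ t.ctx = s.ctx ∧
    Refutes R V x.2 t
  have step : ∀ x : {x // Good x}, ∃ (i : ℕ) (y : {x // Good x}), y.1.1 = x.1.1 ++ [i] ∧
      ∀ t r, π.label x.1.1 = some (t, r) →
        ((∃ A, r = Rule.box A) ∨
        (∃ A, r = Rule.boxPlus A ∧ (i = 1 → failDist R V A y.1.2 < failDist R V A x.1.2)) ∨
        y.1.2 = x.1.2 ∧ ∀ A, r ≠ Rule.boxPlus A) := by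
    rintro ⟨⟨a, u⟩, t, r, hl, hc, hu⟩
    obtain ⟨l, hinf, hch⟩ := π.infer a t r hl
    obtain ⟨i, t', v, hi, hc', hv, hcase⟩ := hinf.exists_refuted (hc ▸ hS) hu
    have := hch i
    rw [hi, Option.map_eq_some_iff] at this
    obtain ⟨⟨t'', r'⟩, hlab, rfl⟩ := this
    refine ⟨i, ⟨(a ++ [i], v), t'', r', hlab, hc'.trans hc, hv⟩, rfl, ?_⟩
    intro t₂ r₂ h₂
    obtain ⟨rfl, rfl⟩ : t = t₂ ∧ r = r₂ := by simpa [hl] using h₂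
    exact hcase
  choose i nxt hn hstep using step
  let x : ℕ → {x // Good x} := fun n => nxt^[n] ⟨([], w), s, r₀, hr₀, rfl, hw⟩
  have hx : ∀ n, x (n + 1) = nxt (x n) := fun n => Function.iterate_succ_apply' _ _ _
  have hb : ∀ n, branchNode (fun k => i (x k)) n = (x n).1.1 := by
    intro n
    induction n with
    | zero => rfl
    | succ n ih => rw [branchNode_succ, ih, hx, hn]
  obtain ⟨N, A, h1, h2, h3⟩ := π.infinite_branch (fun k => i (x k)) (by
    intro n
    rw [hb]
    obtain ⟨t, r, h, -⟩ := (x n).2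
    simp [h])
  simp only [hb] at h1 h2 h3
  -- Infinite descent on the distance to a failure of the formula `A` supplied by the tail
  -- condition.
  refine not_forall_frequently_lt (fun n => failDist R V A (x n).1.2) N ?_ ?_
  · intro n hnN
    obtain ⟨t, r, hl, -⟩ := (x n).2
    simp only [hx]
    rcases hstep (x n) t r hl with ⟨B, rfl⟩ | ⟨B, rfl, hlt⟩ | ⟨he, -⟩
    · exact (h3 n hnN t B hl).elim
    · obtain ⟨rfl, hi⟩ := h1 n hnN t B hl
      exact (hlt hi).le
    · rw [he]
  · intro m
    obtain ⟨n, hmn, hi, t, B, hl⟩ := h2 (max m N)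
    refine ⟨n, (le_max_left _ _).trans hmn, ?_⟩
    simp only [hx]
    obtain ⟨rfl, -⟩ := h1 n ((le_max_right _ _).trans hmn) t B hl
    rcases hstep (x n) t _ hl with ⟨C, hC⟩ | ⟨C, hC, hlt⟩ | ⟨-, hC⟩
    · cases hC
    · cases hC
      exact hlt hi
    · exact (hC _ rfl).elim

end Soundness

/-! ### The finite search space -/

/-- The number of symbols of a formula. -/
def Formula.weight : Formula → ℕ
  | var _ => 1
  | bot => 1
  | imp A B => A.weight + B.weight + 1
  | box A => A.weight + 1
  | boxPlus A => A.weight + 1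

theorem Formula.weight_pos (A : Formula) : 0 < A.weight := by
  cases A <;> simp [weight]

/-- The total number of symbols of a multiset of formulas. -/
def weightSum (G : Multiset Formula) : ℕ := (G.map Formula.weight).sum

@[simp] theorem weightSum_cons (A : Formula) (G : Multiset Formula) :
    weightSum (A ::ₘ G) = A.weight + weightSum G := by
  simp [weightSum]

@[simp] theorem weightSum_add (G D : Multiset Formula) :
    weightSum (G + D) = weightSum G + weightSum D := by
  simp [weightSum]

theorem weightSum_mono {G D : Multiset Formula} (h : G ≤ D) : weightSum G ≤ weightSum D := by
  obtain ⟨F, rfl⟩ := Multiset.le_iff_exists_add.mp h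
  simp

theorem card_le_weightSum (G : Multiset Formula) : Multiset.card G ≤ weightSum G := by
  induction G using Multiset.induction with
  | empty => simp
  | cons A G ih =>
    have := A.weight_pos
    simp
    omega

/-- The total number of symbols of the two sides of a sequent. -/
def Sequent.weight (s : Sequent) : ℕ := weightSum s.left + weightSum s.right

/-- Closure of a set of formulas under immediate subformulas. -/
structure SubformulaClosed (C : Set Formula) : Prop where
  imp_left : ∀ {A B}, imp A B ∈ C → A ∈ C
  imp_right : ∀ {A B}, imp A B ∈ C → B ∈ C
  box : ∀ {A}, Formula.box A ∈ C → A ∈ C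
  boxPlus : ∀ {A}, Formula.boxPlus A ∈ C → A ∈ C

theorem SubformulaClosed.union {C D : Set Formula} (hC : SubformulaClosed C)
    (hD : SubformulaClosed D) : SubformulaClosed (C ∪ D) where
  imp_left h := h.imp hC.imp_left hD.imp_left
  imp_right h := h.imp hC.imp_right hD.imp_right
  box h := h.imp hC.box hD.box
  boxPlus h := h.imp hC.boxPlus hD.boxPlus

theorem exists_subformulaClosed (A : Formula) :
    ∃ C : Set Formula, C.Finite ∧ A ∈ C ∧ SubformulaClosed C := by
  induction A with
  | var n => exact ⟨{var n}, by simp, by simp, by constructor <;> simp⟩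
  | bot => exact ⟨{bot}, by simp, by simp, by constructor <;> simp⟩
  | imp A B ihA ihB =>
    obtain ⟨C, hC, hA, hsC⟩ := ihA
    obtain ⟨D, hD, hB, hsD⟩ := ihB
    have h := hsC.union hsD
    refine ⟨insert (imp A B) (C ∪ D), (hC.union hD).insert _, Set.mem_insert _ _, ?_⟩
    constructor <;> intros <;> simp_all only [Set.mem_insert_iff, Formula.imp.injEq, reduceCtorEq]
    · rename_i h'
      exact .inr (h'.elim (fun e => e.1 ▸ .inl hA) h.imp_left)
    · rename_i h'
      exact .inr (h'.elim (fun e => e.2 ▸ .inr hB) h.imp_right)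
    · rename_i h'
      exact .inr (h'.elim False.elim h.box)
    · rename_i h'
      exact .inr (h'.elim False.elim h.boxPlus)
  | box A ih =>
    obtain ⟨C, hC, hA, h⟩ := ih
    refine ⟨insert (Formula.box A) C, hC.insert _, Set.mem_insert _ _, ?_⟩
    constructor
    · rintro X Y (⟨⟨⟩⟩ | h'); exact .inr (h.imp_left h')
    · rintro X Y (⟨⟨⟩⟩ | h'); exact .inr (h.imp_right h')
    · rintro X (⟨⟨⟩⟩ | h'); exacts [.inr hA, .inr (h.box h')]
    · rintro X (⟨⟨⟩⟩ | h'); exact .inr (h.boxPlus h')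
  | boxPlus A ih =>
    obtain ⟨C, hC, hA, h⟩ := ih
    refine ⟨insert (Formula.boxPlus A) C, hC.insert _, Set.mem_insert _ _, ?_⟩
    constructor
    · rintro X Y (⟨⟨⟩⟩ | h'); exact .inr (h.imp_left h')
    · rintro X Y (⟨⟨⟩⟩ | h'); exact .inr (h.imp_right h')
    · rintro X (⟨⟨⟩⟩ | h'); exact .inr (h.box h')
    · rintro X (⟨⟨⟩⟩ | h'); exacts [.inr hA, .inr (h.boxPlus h')]

theorem exists_subformulaClosed_superset {B : Set Formula} (hB : B.Finite) :
    ∃ C : Set Formula, C.Finite ∧ B ⊆ C ∧ SubformulaClosed C := by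
  induction B, hB using Set.Finite.induction_on with
  | empty => exact ⟨∅, by simp, by simp, by constructor <;> simp⟩
  | @insert A B _ _ ih =>
    obtain ⟨C, hC, hBC, hsC⟩ := ih
    obtain ⟨D, hD, hA, hsD⟩ := exists_subformulaClosed A
    exact ⟨D ∪ C, hD.union hC,
      Set.insert_subset (.inl hA) (hBC.trans Set.subset_union_right), hsD.union hsC⟩

/-- The data bounding proof search: a finite context, a finite subformula-closed set of formulas
containing it, and a bound on the weight of sequents. -/
structure SearchSpace : Type where
  ctx : Finset Formula
  formulas : Finset Formula
  bound : ℕ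
  ctx_subset : ctx ⊆ formulas
  bot_mem : bot ∈ formulas
  closed : SubformulaClosed (formulas : Set Formula)
  le_bound : 5 * weightSum formulas.val ≤ bound

/-- The sequents of a search space. -/
def SearchSpace.sequents (σ : SearchSpace) : Set Sequent :=
  {s | s.ctx = (σ.ctx : Set Formula) ∧ (∀ F ∈ s.left, F ∈ σ.formulas) ∧
    (∀ F ∈ s.right, F ∈ σ.formulas) ∧ s.weight ≤ σ.bound}

/-- Every formula has positive weight, so no formula occurs more than `N` times. -/
theorem finite_setOf_weightSum_le (C : Finset Formula) (N : ℕ) :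
    {G : Multiset Formula | (∀ F ∈ G, F ∈ C) ∧ weightSum G ≤ N}.Finite := by
  classical
  refine (Set.finite_Iic (N • C.val)).subset ?_
  rintro G ⟨hG, hN⟩
  refine Multiset.le_iff_count.mpr fun F => ?_
  rw [Multiset.count_nsmul]
  by_cases hF : F ∈ G
  · rw [Multiset.count_eq_one_of_mem C.nodup (hG F hF), mul_one]
    exact (Multiset.count_le_card _ _).trans ((card_le_weightSum G).trans hN)
  · rw [Multiset.count_eq_zero_of_notMem hF]
    exact Nat.zero_le _

theorem SearchSpace.finite_sequents (σ : SearchSpace) : σ.sequents.Finite := by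
  have h := finite_setOf_weightSum_le σ.formulas σ.bound
  refine ((h.prod h).image fun p => (⟨(σ.ctx : Set Formula), p.1, p.2⟩ : Sequent)).subset ?_
  rintro ⟨S, G, D⟩ ⟨hS, hG, hD, hN⟩
  simp only [Sequent.weight] at hS hG hD hN
  subst hS
  exact ⟨(G, D), ⟨⟨hG, (Nat.le_add_right _ _).trans hN⟩, hD,
    (Nat.le_add_left _ _).trans hN⟩, rfl⟩

/-! ### Provability as a least fixed point of greatest fixed points -/

/-- A step of a proof with focus `A` that does not leave the tail condition: either the right
premise of `□⁺ A` is taken, or a premise of smaller weight of a propositional rule. -/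
def TailStep (A : Formula) (r : Rule) (i : ℕ) (x y : Sequent) : Prop :=
  (r = Rule.boxPlus A ∧ i = 1) ∨
    (y.weight < x.weight ∧ ∀ B, r ≠ Rule.box B ∧ r ≠ Rule.boxPlus B)

/-- The sequent `x` is the conclusion of a cut-free inference whose premises are in `P`, or in `X`
and reached by a step of a tail with focus `A`. -/
def Advance (P X : Set Sequent) (A : Formula) (x : Sequent) : Prop :=
  ∃ r l, Infer r x l ∧ (∀ B, r ≠ Rule.cut B) ∧
    ∀ i y, l[i]? = some y → y ∈ P ∨ (y ∈ X ∧ TailStep A r i x y)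

theorem Advance.mono {P P' X : Set Sequent} (hP : P ⊆ P') {A : Formula} {x : Sequent}
    (h : Advance P X A x) : Advance P' X A x := by
  obtain ⟨r, l, hinf, hcut, hl⟩ := h
  exact ⟨r, l, hinf, hcut, fun i y hy => (hl i y hy).imp_left fun h => hP h⟩

namespace SearchSpace

variable (σ : SearchSpace)

/-- The sequents that have a proof with focus `A` modulo the sequents in `P`. -/
def focused (P : Set Sequent) (A : Formula) : Set Sequent :=
  {s | ∃ X ⊆ σ.sequents, s ∈ X ∧ ∀ x ∈ X, Advance P X A x}

theorem focused_subset (P : Set Sequent) (A : Formula) : σ.focused P A ⊆ σ.sequents :=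
  fun _ ⟨_, hX, hs, _⟩ => hX hs

theorem focused_mono {P P' : Set Sequent} (h : P ⊆ P') (A : Formula) :
    σ.focused P A ⊆ σ.focused P' A :=
  fun _ ⟨X, hX, hs, hadv⟩ => ⟨X, hX, hs, fun x hx => (hadv x hx).mono h⟩

/-- The union of all self-supporting sets `X` is itself self-supporting. -/
theorem focused_advance {P : Set Sequent} {A : Formula} {s : Sequent} (h : s ∈ σ.focused P A) :
    Advance P (σ.focused P A) A s := by
  obtain ⟨X, hX, hs, hadv⟩ := h
  obtain ⟨r, l, hinf, hcut, hl⟩ := hadv s hs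
  exact ⟨r, l, hinf, hcut, fun i y hy => (hl i y hy).imp_right
    fun ⟨hy, ht⟩ => ⟨⟨X, hX, hy, hadv⟩, ht⟩⟩

/-- The sequents provable with at most `n` nested changes of focus. -/
def stage : ℕ → Set Sequent
  | 0 => ∅
  | n + 1 => {s | ∃ A ∈ σ.formulas, s ∈ σ.focused (stage n) A}

theorem stage_subset_succ (n : ℕ) : σ.stage n ⊆ σ.stage (n + 1) := by
  induction n with
  | zero => exact Set.empty_subset _
  | succ n ih => exact fun s ⟨A, hA, hs⟩ => ⟨A, hA, σ.focused_mono ih A hs⟩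

/-- An increasing chain of subsets of the finite set of sequents stabilises. -/
theorem exists_stage_eq : ∃ n, σ.stage (n + 1) = σ.stage n := by
  have hsub : ∀ n, σ.stage n ⊆ σ.sequents := by
    rintro (_ | n)
    · exact Set.empty_subset _
    · rintro s ⟨A, -, hs⟩
      exact σ.focused_subset _ _ hs
  have : Finite σ.sequents := σ.finite_sequents
  let f : ℕ →o Set σ.sequents :=
    ⟨fun n => {x | x.1 ∈ σ.stage n},
      monotone_nat_of_le_succ fun n x hx => σ.stage_subset_succ n hx⟩
  obtain ⟨n, hn⟩ := WellFoundedGT.monotone_chain_condition f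
  refine ⟨n, ((σ.stage_subset_succ n).antisymm fun s hs => ?_).symm⟩
  have h := hn (n + 1) n.le_succ
  have hs' : (⟨s, hsub _ hs⟩ : σ.sequents) ∈ f (n + 1) := hs
  rw [← h] at hs'
  exact hs'

end SearchSpace

/-! ### Regular cut-free proofs from the stages -/

/-- A node of the proof under construction: stage, focus and sequent. -/
structure SearchState : Type where
  level : ℕ
  focus : Formula
  seq : Sequent

namespace SearchSpace

variable (σ : SearchSpace)

/-- The states whose sequent is provable with the given focus at the given stage. -/
def validStates : Set SearchState :=
  {t | t.focus ∈ σ.formulas ∧ t.seq ∈ σ.focused (σ.stage t.level) t.focus}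

/-- Along an edge of the proof graph the level drops, or the level and the focus stay the same and
the step respects the tail condition. -/
def Descends (r : Rule) (i : ℕ) (t t' : SearchState) : Prop :=
  t'.level < t.level ∨
    (t'.level = t.level ∧ t'.focus = t.focus ∧ TailStep t.focus r i t.seq t'.seq)

/-- A premise in `P` was proved at an earlier stage, so it takes a lower level and possibly a new
focus; any other premise keeps both and is reached by a tail step. -/
theorem exists_expansion {t : SearchState} (ht : t ∈ σ.validStates) :
    ∃ (r : Rule) (next : ℕ → Option SearchState), (∀ B, r ≠ Rule.cut B) ∧
      (∃ l, Infer r t.seq l ∧ ∀ i, (next i).map SearchState.seq = l[i]?) ∧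
      ∀ i t', next i = some t' → t' ∈ σ.validStates ∧ t'.level ≤ t.level ∧ Descends r i t t' := by
  obtain ⟨n, A, s⟩ := t
  obtain ⟨hA, hs⟩ := ht
  obtain ⟨r, l, hinf, hcut, hl⟩ := σ.focused_advance hs
  have key : ∀ i, ∃ o : Option SearchState, o.map SearchState.seq = l[i]? ∧
      ∀ t', o = some t' → t' ∈ σ.validStates ∧ t'.level ≤ n ∧ Descends r i ⟨n, A, s⟩ t' := by
    intro i
    rcases hi : l[i]? with _ | y
    · exact ⟨none, rfl, by simp⟩
    · rcases hl i y hi with hy | ⟨hy, ht⟩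
      · cases n with
        -- A state of level `n` works modulo `stage n`, so at level zero no premise can be passed
        -- down.
        | zero => exact hy.elim
        | succ n =>
          obtain ⟨B, hB, hy⟩ := hy
          refine ⟨some ⟨n, B, y⟩, rfl, ?_⟩
          rintro _ ⟨⟩
          exact ⟨⟨hB, hy⟩, n.le_succ, .inl n.lt_succ_self⟩
      · refine ⟨some ⟨n, A, y⟩, rfl, ?_⟩
        rintro _ ⟨⟩
        exact ⟨⟨hA, hy⟩, le_rfl, .inr ⟨rfl, rfl, ht⟩⟩
  choose next h1 h2 using key
  exact ⟨r, next, hcut, ⟨l, hinf, h1⟩, h2⟩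

end SearchSpace

/-- The state reached from `o` along an address in the graph given by `next`. -/
def walk {T : Type*} (next : T → ℕ → Option T) (o : Option T) (a : List ℕ) : Option T :=
  a.foldl (fun o i => o.bind fun t => next t i) o

theorem walk_append {T : Type*} (next : T → ℕ → Option T) (o : Option T) (a c : List ℕ) :
    walk next o (a ++ c) = walk next (walk next o a) c :=
  List.foldl_append

theorem walk_snoc {T : Type*} (next : T → ℕ → Option T) (o : Option T) (a : List ℕ) (i : ℕ) :
    walk next o (a ++ [i]) = (walk next o a).bind fun t => next t i := by
  rw [walk_append]
  rfl

/-- In an infinite walk descending at each step, the tail condition holds. -/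
theorem exists_tail {t : ℕ → SearchState} {r : ℕ → Rule} {b : ℕ → ℕ}
    (h : ∀ n, SearchSpace.Descends (r n) (b n) (t n) (t (n + 1))) :
    ∃ (N : ℕ) (A : Formula),
      (∀ n, N ≤ n → ∀ B, r n = Rule.boxPlus B → B = A ∧ b n = 1) ∧
      (∀ m, ∃ n, m ≤ n ∧ b n = 1 ∧ ∃ B, r n = Rule.boxPlus B) ∧
      ∀ n, N ≤ n → ∀ B, r n ≠ Rule.box B := by
  -- Levels never rise, so they drop only finitely often; afterwards the focus is constant.
  have hlevel : ∃ N, ∀ n, N ≤ n → ¬ (t (n + 1)).level < (t n).level := by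
    by_contra! hcon
    exact not_forall_frequently_lt (fun n => (t n).level) 0
      (fun n _ => (h n).elim le_of_lt fun h => h.1.le) hcon
  obtain ⟨N, hN⟩ := hlevel
  have htail : ∀ n, N ≤ n → (t (n + 1)).focus = (t n).focus ∧
      TailStep (t n).focus (r n) (b n) (t n).seq (t (n + 1)).seq :=
    fun n hn => ((h n).resolve_left (hN n hn)).2
  have hfocus : ∀ n, N ≤ n → (t n).focus = (t N).focus :=
    Nat.le_induction rfl fun n hn ih => (htail n hn).1.trans ih
  refine ⟨N, (t N).focus, ?_, ?_, ?_⟩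
  · intro n hn B hB
    rcases (htail n hn).2 with ⟨h1, h2⟩ | ⟨-, h2⟩
    · rw [hB] at h1
      cases h1
      exact ⟨hfocus n hn, h2⟩
    · exact ((h2 B).2 hB).elim
  -- If right premises of `□⁺` ceased, only weight-decreasing propositional steps would remain.
  · by_contra! hcon
    obtain ⟨m, hm⟩ := hcon
    have hlt : ∀ n, max m N ≤ n → (t (n + 1)).seq.weight < (t n).seq.weight := by
      intro n hn
      rcases (htail n (by omega)).2 with ⟨h1, h2⟩ | ⟨h1, -⟩
      · exact (hm n (by omega) h2 _ h1).elim
      · exact h1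
    exact not_forall_frequently_lt (fun n => (t n).seq.weight) (max m N)
      (fun n hn => (hlt n hn).le)
      fun k => ⟨max k (max m N), le_max_left _ _, hlt _ (le_max_right _ _)⟩
  · intro n hn B hB
    rcases (htail n hn).2 with ⟨h1, -⟩ | ⟨-, h2⟩
    · rw [hB] at h1
      cases h1
    · exact (h2 B).1 hB

theorem SearchSpace.exists_regular (σ : SearchSpace) {t₀ : SearchState}
    (ht₀ : t₀ ∈ σ.validStates) :
    ∃ π : InfProof, π.Proves t₀.seq ∧ π.CutFree ∧ π.Regular := by
  classical
  have key : ∀ t : SearchState, ∃ (r : Rule) (next : ℕ → Option SearchState), t ∈ σ.validStates →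
      (∀ B, r ≠ Rule.cut B) ∧
      (∃ l, Infer r t.seq l ∧ ∀ i, (next i).map SearchState.seq = l[i]?) ∧
      ∀ i t', next i = some t' →
        t' ∈ σ.validStates ∧ t'.level ≤ t.level ∧ Descends r i t t' := by
    intro t
    by_cases ht : t ∈ σ.validStates
    · obtain ⟨r, next, h⟩ := σ.exists_expansion ht
      exact ⟨r, next, fun _ => h⟩
    -- Dummy value: only valid states are reached from `t₀`.
    · exact ⟨Rule.botL, fun _ => none, fun h => (ht h).elim⟩
  choose r next hexp using key
  let lab : SearchState → Sequent × Rule := fun t => (t.seq, r t)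
  have hvalid : ∀ a t, walk next (some t₀) a = some t →
      t ∈ σ.validStates ∧ t.level ≤ t₀.level := by
    intro a
    induction a using List.reverseRecOn with
    | nil =>
      rintro _ ⟨⟩
      exact ⟨ht₀, le_rfl⟩
    | append_singleton a i ih =>
      intro t ht
      rw [walk_snoc, Option.bind_eq_some_iff] at ht
      obtain ⟨u, hu, hut⟩ := ht
      obtain ⟨hu1, hu2⟩ := ih u hu
      obtain ⟨h1, h2, -⟩ := (hexp u hu1).2.2 i t hut
      exact ⟨h1, h2.trans hu2⟩
  have hlab : ∀ a s ρ, (walk next (some t₀) a).map lab = some (s, ρ) →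
      ∃ t, walk next (some t₀) a = some t ∧ t ∈ σ.validStates ∧ s = t.seq ∧ ρ = r t := by
    intro a s ρ h
    obtain ⟨t, ht, he⟩ := Option.map_eq_some_iff.mp h
    cases he
    exact ⟨t, ht, (hvalid a t ht).1, rfl, rfl⟩
  refine ⟨{ label := fun a => (walk next (some t₀) a).map lab
            root_isSome := rfl
            label_none := ?_
            infer := ?_
            infinite_branch := ?_ }, ⟨r t₀, rfl⟩, ?_, ?_⟩
  · intro a i h
    rw [Option.map_eq_none_iff] at h
    rw [walk_snoc, h]
    rfl
  · intro a s ρ h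
    obtain ⟨t, ht, htv, rfl, rfl⟩ := hlab a s ρ h
    obtain ⟨l, hinf, hl⟩ := (hexp t htv).2.1
    refine ⟨l, hinf, fun i => ?_⟩
    rw [walk_snoc, ht, ← hl i, Option.map_map]
    rfl
  · intro b hb
    have hsome : ∀ n, ∃ t, walk next (some t₀) (branchNode b n) = some t := by
      intro n
      have := hb n
      rwa [Option.isSome_map, Option.isSome_iff_exists] at this
    choose t ht using hsome
    obtain ⟨N, A, h1, h2, h3⟩ := exists_tail (t := t) (r := fun n => r (t n)) (b := b) (by
      intro n
      have hn := ht (n + 1)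
      rw [branchNode_succ, walk_snoc, ht n] at hn
      exact ((hexp (t n) (hvalid _ _ (ht n)).1).2.2 _ _ hn).2.2)
    simp only [ht, Option.map_some, lab, Option.some.injEq, Prod.mk.injEq, ne_eq]
    exact ⟨N, A, fun n hn s B hB => h1 n hn B hB.2,
      fun m => (h2 m).imp fun n ⟨hmn, hbn, B, hB⟩ => ⟨hmn, hbn, _, B, rfl, hB⟩,
      fun n hn s B hB => h3 n hn B hB.2⟩
  · intro a s A h
    obtain ⟨t, -, htv, -, he⟩ := hlab a s _ h
    exact (hexp t htv).1 A he.symm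
  -- A subtree is determined by the state at its root, and the reachable states form a finite set.
  · have hfin : (Set.Iic t₀.level ×ˢ (σ.formulas : Set Formula) ×ˢ σ.sequents).Finite :=
      (Set.finite_Iic _).prod (σ.formulas.finite_toSet.prod σ.finite_sequents)
    refine (hfin.image fun p c =>
      (walk next (some ⟨p.1, p.2.1, p.2.2⟩) c).map lab).subset ?_
    rintro _ ⟨a, ha, rfl⟩
    rw [Option.isSome_map, Option.isSome_iff_exists] at ha
    obtain ⟨t, ht⟩ := ha
    obtain ⟨⟨hA, hs⟩, hlev⟩ := hvalid a t ht
    refine ⟨(t.level, t.focus, t.seq), ⟨hlev, hA, σ.focused_subset _ _ hs⟩, ?_⟩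
    funext c
    simp only [InfProof.subtree, walk_append, ht]

/-! ### Saturation and the canonical countermodel -/

/-- `s'` is a premise of a propositional rule applied to `s`. -/
inductive PropStep : Sequent → Sequent → Prop
  | impL_left (S : Set Formula) (G D : Multiset Formula) (A B : Formula) :
      PropStep ⟨S, imp A B ::ₘ G, D⟩ ⟨S, B ::ₘ G, D⟩
  | impL_right (S : Set Formula) (G D : Multiset Formula) (A B : Formula) :
      PropStep ⟨S, imp A B ::ₘ G, D⟩ ⟨S, G, A ::ₘ D⟩
  | impR (S : Set Formula) (G D : Multiset Formula) (A B : Formula) :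
      PropStep ⟨S, G, imp A B ::ₘ D⟩ ⟨S, A ::ₘ G, B ::ₘ D⟩

/-- `s'` is obtained from `s` by going up through propositional rules. -/
abbrev Reduces : Sequent → Sequent → Prop := Relation.ReflTransGen PropStep

/-- No implication occurs in the two sides of the sequent. -/
def Saturated (s : Sequent) : Prop := ∀ A B, imp A B ∉ s.left ∧ imp A B ∉ s.right

theorem PropStep.weight_lt {s s' : Sequent} (h : PropStep s s') : s'.weight < s.weight := by
  cases h <;> simp [Sequent.weight, Formula.weight] <;> omega

theorem PropStep.mem_sequents {σ : SearchSpace} {s s' : Sequent} (h : PropStep s s')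
    (hs : s ∈ σ.sequents) : s' ∈ σ.sequents := by
  have hw := h.weight_lt
  obtain ⟨h1, h2, h3, h4⟩ := hs
  have hl : ∀ {A B}, imp A B ∈ σ.formulas → A ∈ σ.formulas := fun h => σ.closed.imp_left h
  have hr : ∀ {A B}, imp A B ∈ σ.formulas → B ∈ σ.formulas := fun h => σ.closed.imp_right h
  refine ⟨?_, ?_, ?_, hw.le.trans h4⟩ <;> cases h <;>
    simp only [Multiset.mem_cons, forall_eq_or_imp] at *
  all_goals first
    | assumption
    | exact h2.2
    | exact h3.2
    | exact ⟨hr h2.1, h2.2⟩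
    | exact ⟨hl h2.1, h3⟩
    | exact ⟨hl h3.1, h2⟩
    | exact ⟨hr h3.1, h3.2⟩

/-- A sequent that is not saturated is the conclusion of a propositional rule. -/
theorem exists_prop_infer {s : Sequent} (h : ¬ Saturated s) :
    ∃ r l, Infer r s l ∧ (∀ y ∈ l, PropStep s y) ∧
      ∀ B, r ≠ Rule.cut B ∧ r ≠ Rule.box B ∧ r ≠ Rule.boxPlus B := by
  obtain ⟨S, G, D⟩ := s
  simp only [Saturated, not_forall, not_and_or, not_not] at h
  obtain ⟨A, B, h | h⟩ := h
  · obtain ⟨G, rfl⟩ := Multiset.exists_cons_of_mem h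
    refine ⟨_, _, .impL S G D A B, ?_, by simp⟩
    simp only [List.mem_cons, List.not_mem_nil, or_false, forall_eq_or_imp, forall_eq]
    exact ⟨.impL_left .., .impL_right ..⟩
  · obtain ⟨D, rfl⟩ := Multiset.exists_cons_of_mem h
    refine ⟨_, _, .impR S G D A B, ?_, by simp⟩
    simp only [List.mem_cons, List.not_mem_nil, or_false, forall_eq]
    exact .impR ..

/-- What becomes of a formula on the left when going up to a saturated sequent. -/
theorem Reduces.left_cases {s w : Sequent} (h : Reduces s w) {F : Formula} (hF : F ∈ s.left) :
    F ∈ w.left ∨ ∃ A B s', F = imp A B ∧ Reduces s' w ∧ (B ∈ s'.left ∨ A ∈ s'.right) := by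
  induction h using Relation.ReflTransGen.head_induction_on with
  | refl => exact .inl hF
  | head hstep hrest ih =>
    cases hstep with
    | impL_left S G D A B =>
      rcases Multiset.mem_cons.mp hF with rfl | hF
      · exact .inr ⟨A, B, _, rfl, hrest, .inl (by simp)⟩
      · exact ih (by simp [hF])
    | impL_right S G D A B =>
      rcases Multiset.mem_cons.mp hF with rfl | hF
      · exact .inr ⟨A, B, _, rfl, hrest, .inr (by simp)⟩
      · exact ih hF
    | impR S G D A B => exact ih (by simpa using .inr hF)

/-- What becomes of a formula on the right when going up to a saturated sequent. -/
theorem Reduces.right_cases {s w : Sequent} (h : Reduces s w) {F : Formula} (hF : F ∈ s.right) :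
    F ∈ w.right ∨ ∃ A B s', F = imp A B ∧ Reduces s' w ∧ A ∈ s'.left ∧ B ∈ s'.right := by
  induction h using Relation.ReflTransGen.head_induction_on with
  | refl => exact .inl hF
  | head hstep hrest ih =>
    cases hstep with
    | impL_left S G D A B => exact ih hF
    | impL_right S G D A B => exact ih (by simpa using .inr hF)
    | impR S G D A B =>
      rcases Multiset.mem_cons.mp hF with rfl | hF
      · exact .inr ⟨A, B, _, rfl, hrest, by simp, by simp⟩
      · exact ih (by simp [hF])

/-! ### Canonical premises of the modal rules -/

/-- The formulas `B` with `□ B` in `G`. -/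
noncomputable def unbox (G : Multiset Formula) : Finset Formula :=
  open Classical in G.toFinset.preimage Formula.box fun _ _ _ _ h => Formula.box.inj h

/-- The formulas `B` with `□⁺ B` in `G`. -/
noncomputable def unboxPlus (G : Multiset Formula) : Finset Formula :=
  open Classical in G.toFinset.preimage Formula.boxPlus fun _ _ _ _ h => Formula.boxPlus.inj h

@[simp] theorem mem_unbox {G : Multiset Formula} {B : Formula} :
    B ∈ unbox G ↔ Formula.box B ∈ G := by
  classical exact Finset.mem_preimage.trans Multiset.mem_toFinset

@[simp] theorem mem_unboxPlus {G : Multiset Formula} {B : Formula} :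
    B ∈ unboxPlus G ↔ Formula.boxPlus B ∈ G := by
  classical exact Finset.mem_preimage.trans Multiset.mem_toFinset

theorem nodup_map_boxPlus (G : Multiset Formula) :
    ((unboxPlus G).val.map Formula.boxPlus).Nodup :=
  (unboxPlus G).nodup.map fun _ _ h => Formula.boxPlus.inj h

/-- One copy of each boxed formula is extracted. Repetitions stay in `F`, which the modal rules
discard, so canonical premises have bounded weight. -/
theorem exists_eq_add_boxes (G : Multiset Formula) :
    ∃ F, G = F + (unbox G).val.map Formula.box + (unboxPlus G).val.map Formula.boxPlus := by
  have hle : (unbox G).val.map Formula.box + (unboxPlus G).val.map Formula.boxPlus ≤ G := by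
    rw [Multiset.le_iff_subset]
    · intro F hF
      simp only [Multiset.mem_add, Multiset.mem_map, Finset.mem_val, mem_unbox,
        mem_unboxPlus] at hF
      rcases hF with ⟨B, hB, rfl⟩ | ⟨B, hB, rfl⟩ <;> exact hB
    · rw [Multiset.nodup_add]
      refine ⟨(unbox G).nodup.map fun _ _ h => Formula.box.inj h, nodup_map_boxPlus G, ?_⟩
      rw [Multiset.disjoint_left]
      simp
  obtain ⟨F, hF⟩ := Multiset.le_iff_exists_add.mp hle
  exact ⟨F, by rw [add_assoc, add_comm F]; exact hF⟩

namespace SearchSpace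

variable (σ : SearchSpace)

/-- The premise of a modal rule applied to a sequent with left side `G`, with right side `A`. -/
noncomputable def modalPremise (G : Multiset Formula) (A : Formula) : Sequent :=
  ⟨σ.ctx, σ.ctx.val + (unbox G).val + (unboxPlus G).val +
    (unboxPlus G).val.map Formula.boxPlus, {A}⟩

variable {σ}

theorem modalPremise_mem {G : Multiset Formula} (hG : ∀ F ∈ G, F ∈ σ.formulas) {A : Formula}
    (hA : A ∈ σ.formulas) : σ.modalPremise G A ∈ σ.sequents := by
  have hL : unbox G ⊆ σ.formulas := fun B hB => σ.closed.box (hG _ (mem_unbox.mp hB))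
  have hP : unboxPlus G ⊆ σ.formulas :=
    fun B hB => σ.closed.boxPlus (hG _ (mem_unboxPlus.mp hB))
  have hPP : ∀ F ∈ (unboxPlus G).val.map Formula.boxPlus, F ∈ σ.formulas := by
    intro F hF
    obtain ⟨B, hB, rfl⟩ := Multiset.mem_map.mp hF
    exact hG _ (mem_unboxPlus.mp hB)
  refine ⟨rfl, ?_, by simpa [modalPremise] using hA, ?_⟩
  · intro F hF
    simp only [modalPremise, Multiset.mem_add, Finset.mem_val] at hF
    rcases hF with ((hF | hF) | hF) | hF
    exacts [σ.ctx_subset hF, hL hF, hP hF, hPP F hF]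
  -- Four parts on the left and one formula on the right, each of weight at most that of all
  -- `formulas` together: this is the factor 5 in `le_bound`.
  · have h1 := weightSum_mono (Finset.val_le_iff.mpr σ.ctx_subset)
    have h2 := weightSum_mono (Finset.val_le_iff.mpr hL)
    have h3 := weightSum_mono (Finset.val_le_iff.mpr hP)
    have h4 := weightSum_mono ((Multiset.le_iff_subset (nodup_map_boxPlus G)).mpr hPP)
    have h5 := weightSum_mono (Multiset.singleton_le.mpr hA)
    have h6 := σ.le_bound
    simp only [Sequent.weight, modalPremise, weightSum_add]
    omega

theorem infer_box {s : Sequent} (hs : s ∈ σ.sequents) {A : Formula}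
    (hA : Formula.box A ∈ s.right) : Infer (Rule.box A) s [σ.modalPremise s.left A] := by
  obtain ⟨S, G, D⟩ := s
  obtain ⟨rfl, -⟩ := hs
  obtain ⟨D, rfl⟩ := Multiset.exists_cons_of_mem hA
  obtain ⟨F, hF⟩ := exists_eq_add_boxes G
  have := Infer.box (σ.ctx : Set Formula) σ.ctx subset_rfl F (unbox G).val (unboxPlus G).val D A
  rwa [← hF] at this

theorem infer_boxPlus {s : Sequent} (hs : s ∈ σ.sequents) {A : Formula}
    (hA : Formula.boxPlus A ∈ s.right) : Infer (Rule.boxPlus A) s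
      [σ.modalPremise s.left A, σ.modalPremise s.left (Formula.boxPlus A)] := by
  obtain ⟨S, G, D⟩ := s
  obtain ⟨rfl, -⟩ := hs
  obtain ⟨D, rfl⟩ := Multiset.exists_cons_of_mem hA
  obtain ⟨F, hF⟩ := exists_eq_add_boxes G
  have := Infer.boxPlus (σ.ctx : Set Formula) σ.ctx subset_rfl F (unbox G).val
    (unboxPlus G).val D A
  rwa [← hF] at this

/-! ### Fixed sets and their countermodels -/

variable (σ) in
/-- `P` contains every sequent that has a proof with some focus modulo `P`. -/
def IsFixed (P : Set Sequent) : Prop := ∀ A ∈ σ.formulas, σ.focused P A ⊆ P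

theorem IsFixed.mem_of_infer {P : Set Sequent} (hP : σ.IsFixed P) {s : Sequent}
    (hs : s ∈ σ.sequents) {r : Rule} {l : List Sequent} (h : Infer r s l) (hr : ∀ B, r ≠ Rule.cut B) (hl : ∀ y ∈ l, y ∈ P) : s ∈ P := by
  -- All premises already lie in `P`, so the focus is immaterial and `bot` serves.
  refine hP bot σ.bot_mem ⟨{s}, by simpa using hs, rfl, ?_⟩
  rintro _ rfl
  exact ⟨r, l, h, hr, fun i y hy => .inl (hl y (List.mem_of_getElem? hy))⟩

/-- A sequent outside `P` has a premise outside `P` under any applicable propositional rule, and the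
weight falls. -/
theorem IsFixed.exists_saturated {P : Set Sequent} (hP : σ.IsFixed P) {s : Sequent}
    (hs : s ∈ σ.sequents) (hsP : s ∉ P) : ∃ w, Reduces s w ∧ w ∈ σ.sequents ∧ w ∉ P ∧ Saturated w := by
  induction hn : s.weight using Nat.strong_induction_on generalizing s with
  | _ n ih =>
    subst hn
    by_cases hsat : Saturated s
    · exact ⟨s, .refl, hs, hsP, hsat⟩
    · obtain ⟨r, l, hinf, hl, hr⟩ := exists_prop_infer hsat
      have : ∃ y ∈ l, y ∉ P := by
        by_contra! hcon
        exact hsP (hP.mem_of_infer hs hinf (fun B => (hr B).1) hcon)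
      obtain ⟨y, hy, hyP⟩ := this
      obtain ⟨w, hyw, hw⟩ := ih _ (hl y hy).weight_lt ((hl y hy).mem_sequents hs) hyP rfl
      exact ⟨w, .head (hl y hy) hyw, hw⟩

/-- The worlds of the canonical model: the saturated sequents of the search space outside `P`. -/
def World (σ : SearchSpace) (P : Set Sequent) : Type :=
  {w : Sequent // w ∈ σ.sequents ∧ w ∉ P ∧ Saturated w}

/-- Accessibility of the canonical model. -/
def Accessible {P : Set Sequent} (w v : World σ P) : Prop :=
  ∃ s, Reduces s v.1 ∧ (∀ F ∈ σ.ctx, F ∈ s.left) ∧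
    (∀ B, Formula.box B ∈ w.1.left → B ∈ s.left) ∧
    ∀ B, Formula.boxPlus B ∈ w.1.left → B ∈ s.left ∧ Formula.boxPlus B ∈ s.left

/-- Truth in the canonical model. -/
abbrev Holds {P : Set Sequent} (F : Formula) (w : World σ P) : Prop :=
  Sat Accessible (fun v p => var p ∈ v.1.left) F w

theorem accessible_of_reduces {P : Set Sequent} {w v : World σ P} {A : Formula}
    (h : Reduces (σ.modalPremise w.1.left A) v.1) : Accessible w v := by
  refine ⟨_, h, ?_, ?_, ?_⟩ <;> simp only [modalPremise, Multiset.mem_add, Finset.mem_val,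
    mem_unbox, mem_unboxPlus, Multiset.mem_map]
  · exact fun F hF => .inl (.inl (.inl hF))
  · exact fun B hB => .inl (.inl (.inr hB))
  · exact fun B hB => ⟨.inl (.inr hB), .inr ⟨B, hB, rfl⟩⟩

theorem Accessible.boxPlus_mem {P : Set Sequent} {w v : World σ P} (h : Accessible w v)
    {B : Formula} (hB : Formula.boxPlus B ∈ w.1.left) : Formula.boxPlus B ∈ v.1.left := by
  obtain ⟨s, hs, -, -, h⟩ := h
  rcases hs.left_cases (h B hB).2 with h | ⟨_, _, _, h, -⟩
  · exact h
  · cases h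

/-- If `□⁺ A` is true at a world of the canonical model then it is not on its right side, provided
`A` is false where it is on the right side of a sequent below. -/
theorem IsFixed.boxPlus_notMem {P : Set Sequent} (hP : σ.IsFixed P) {A : Formula}
    (ih : ∀ (w : World σ P) (s : Sequent), Reduces s w.1 → A ∈ s.right → ¬ Holds A w)
    (w : World σ P) (hw : Holds (Formula.boxPlus A) w) : Formula.boxPlus A ∉ w.1.right := by
  intro hmem
  have hAA : Formula.boxPlus A ∈ σ.formulas := w.2.1.2.2.1 _ hmem
  have hA : A ∈ σ.formulas := σ.closed.boxPlus hAA
  -- Coinduction: the set below supports itself with focus `A`, so it would put `w` into `P`.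
  refine w.2.2.1 (hP A hA ⟨{s | s ∈ σ.sequents ∧ s ∉ P ∧ Formula.boxPlus A ∈ s.right ∧
    ∀ v : World σ P, Reduces s v.1 → Holds (Formula.boxPlus A) v}, fun s hs => hs.1, ?_, ?_⟩)
  · refine ⟨w.2.1, w.2.2.1, hmem, fun v hv => ?_⟩
    -- A saturated sequent reduces only to itself.
    have : w = v := by
      apply Subtype.ext
      rcases Relation.ReflTransGen.cases_head hv with h | ⟨y, hy, -⟩
      · exact h
      · cases hwv : w.1 with
        | mk S G D =>
          have hsat := w.2.2.2
          rw [hwv] at hsat hy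
          cases hy
          · exact ((hsat _ _).1 (Multiset.mem_cons_self _ _)).elim
          · exact ((hsat _ _).1 (Multiset.mem_cons_self _ _)).elim
          · exact ((hsat _ _).2 (Multiset.mem_cons_self _ _)).elim
    exact this ▸ hw
  · rintro s ⟨hs, hsP, hsA, hsat⟩
    by_cases hprop : Saturated s
    · refine ⟨_, _, infer_boxPlus hs hsA, by simp, ?_⟩
      let u : World σ P := ⟨s, hs, hsP, hprop⟩
      have hu : Holds (Formula.boxPlus A) u := hsat u .refl
      rintro (_ | _ | i) y hy
      · cases hy
        left
        -- Outside `P`, the left premise would saturate to a successor of `u` falsifying `A`.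
        by_contra hy
        obtain ⟨v, hv, hv'⟩ := hP.exists_saturated (modalPremise_mem hs.2.1 hA) hy
        exact ih ⟨v, hv'⟩ _ hv (Multiset.mem_singleton_self _)
          (hu _ (.single (accessible_of_reduces (w := u) hv)))
      · cases hy
        refine or_iff_not_imp_left.mpr fun hyP => ⟨⟨modalPremise_mem hs.2.1 hAA, hyP,
          Multiset.mem_singleton_self _, ?_⟩, .inl ⟨rfl, rfl⟩⟩
        -- Worlds above the right premise are successors of `u`, and `□⁺ A` is inherited by
        -- successors.
        exact fun v hv x hx => hu x (.head (accessible_of_reduces (w := u) hv) hx)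
      · cases hy
    · obtain ⟨r, l, hinf, hl, hr⟩ := exists_prop_infer hprop
      refine ⟨r, l, hinf, fun B => (hr B).1, fun i y hy => or_iff_not_imp_left.mpr fun hyP => ?_⟩
      have hy := hl y (List.mem_of_getElem? hy)
      refine ⟨⟨hy.mem_sequents hs, hyP, ?_, fun v hv => hsat v (.head hy hv)⟩,
        .inr ⟨hy.weight_lt, fun B => (hr B).2⟩⟩
      cases hy <;> simp_all

/-- The truth lemma for the canonical model. -/
theorem IsFixed.truth {P : Set Sequent} (hP : σ.IsFixed P) (F : Formula) (w : World σ P)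
    (s : Sequent) (h : Reduces s w.1) :
    (F ∈ s.left → Holds F w) ∧ (F ∈ s.right → ¬ Holds F w) := by
  -- Worlds contain no implications, so the claim must range over every `s` reducing to `w`: an
  -- implication is handled where it is decomposed.
  induction F generalizing w s with
  | var p =>
    have hl : var p ∈ s.left → var p ∈ w.1.left := fun hF =>
      (h.left_cases hF).resolve_right (by rintro ⟨_, _, _, h, -⟩; cases h)
    refine ⟨hl, fun hF hw => w.2.2.1 ?_⟩
    have hr : var p ∈ w.1.right :=
      (h.right_cases hF).resolve_right (by rintro ⟨_, _, _, h, -⟩; cases h)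
    obtain ⟨G, hG⟩ := Multiset.exists_cons_of_mem hw
    obtain ⟨D, hD⟩ := Multiset.exists_cons_of_mem hr
    have hinf := Infer.ax w.1.ctx G D p
    rw [← hG, ← hD] at hinf
    exact hP.mem_of_infer w.2.1 hinf (by simp) (by simp)
  | bot =>
    refine ⟨fun hF => (w.2.2.1 ?_).elim, fun _ h => h⟩
    have hl : bot ∈ w.1.left :=
      (h.left_cases hF).resolve_right (by rintro ⟨_, _, _, h, -⟩; cases h)
    obtain ⟨G, hG⟩ := Multiset.exists_cons_of_mem hl
    have hinf := Infer.botL w.1.ctx G w.1.right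
    rw [← hG] at hinf
    exact hP.mem_of_infer w.2.1 hinf (by simp) (by simp)
  | imp A B ihA ihB =>
    constructor
    · intro hF hA
      rcases h.left_cases hF with hF | ⟨_, _, s', he, hs', hB | hA'⟩
      · exact ((w.2.2.2 A B).1 hF).elim
      · cases he
        exact (ihB w s' hs').1 hB
      · cases he
        exact ((ihA w s' hs').2 hA' hA).elim
    · intro hF himp
      rcases h.right_cases hF with hF | ⟨_, _, s', he, hs', hA, hB⟩
      · exact (w.2.2.2 A B).2 hF
      · cases he
        exact (ihB w s' hs').2 hB (himp ((ihA w s' hs').1 hA))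
  | box A ih =>
    constructor
    · rintro hF v ⟨s', hs', -, hbox, -⟩
      have hl : Formula.box A ∈ w.1.left :=
        (h.left_cases hF).resolve_right (by rintro ⟨_, _, _, h, -⟩; cases h)
      exact (ih v s' hs').1 (hbox A hl)
    · intro hF hw
      have hr : Formula.box A ∈ w.1.right :=
        (h.right_cases hF).resolve_right (by rintro ⟨_, _, _, h, -⟩; cases h)
      refine w.2.2.1 (hP.mem_of_infer w.2.1 (infer_box w.2.1 hr) (by simp) ?_)
      simp only [List.mem_singleton, forall_eq]
      by_contra hy
      obtain ⟨v, hv, hv'⟩ := hP.exists_saturated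
        (modalPremise_mem w.2.1.2.1 (σ.closed.box (w.2.1.2.2.1 _ hr))) hy
      exact (ih ⟨v, hv'⟩ _ hv).2 (Multiset.mem_singleton_self _)
        (hw _ (accessible_of_reduces hv))
  | boxPlus A ih =>
    constructor
    · intro hF v hv
      have hl : Formula.boxPlus A ∈ w.1.left :=
        (h.left_cases hF).resolve_right (by rintro ⟨_, _, _, h, -⟩; cases h)
      -- Along the path `□⁺ A` persists on the left, and the last step releases `A`.
      clear hF h
      induction hv using Relation.TransGen.head_induction_on with
      | single hwv =>
        obtain ⟨s', hs', -, -, hplus⟩ := hwv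
        exact (ih v s' hs').1 (hplus A hl).1
      | head hwu _ ihv => exact ihv (hwu.boxPlus_mem hl)
    · intro hF hw
      have hr : Formula.boxPlus A ∈ w.1.right :=
        (h.right_cases hF).resolve_right (by rintro ⟨_, _, _, h, -⟩; cases h)
      exact hP.boxPlus_notMem (fun v t ht => (ih v t ht).2) w hw hr

/-- A sequent of the search space that is refuted by no world of a model whose successors satisfy
the context belongs to every fixed set. -/
theorem IsFixed.complete {P : Set Sequent} (hP : σ.IsFixed P) {s : Sequent}
    (hs : s ∈ σ.sequents)
    (hvalid : ∀ (W : Type) (R : W → W → Prop) (V : W → ℕ → Prop),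
      (∀ w v, R w v → ∀ F ∈ s.ctx, Sat R V F v) → ∀ w, ¬ Refutes R V w s) : s ∈ P := by
  by_contra hsP
  obtain ⟨w, hw, hw'⟩ := hP.exists_saturated hs hsP
  refine hvalid (World σ P) Accessible (fun v p => var p ∈ v.1.left) ?_ ⟨w, hw'⟩
    ⟨fun F hF => (hP.truth F ⟨w, hw'⟩ s hw).1 hF, fun F hF => (hP.truth F ⟨w, hw'⟩ s hw).2 hF⟩
  rintro u v ⟨s', hs', hctx, -⟩ F hF
  rw [hs.1] at hF
  exact (hP.truth F v s' hs').1 (hctx F hF)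

end SearchSpace

theorem SearchSpace.exists_of_sequent {S : Set Formula} (hS : S.Finite)
    (Γ Δ : Multiset Formula) : ∃ σ : SearchSpace, (⟨S, Γ, Δ⟩ : Sequent) ∈ σ.sequents := by
  have hfin : (insert bot (S ∪ ({F | F ∈ Γ} ∪ {F | F ∈ Δ}))).Finite := by
    classical
    refine (hS.union (Set.Finite.union ?_ ?_)).insert _
    · exact Γ.toFinset.finite_toSet.subset fun F hF => by simpa using hF
    · exact Δ.toFinset.finite_toSet.subset fun F hF => by simpa using hF
  obtain ⟨C, hC, hsub, hclosed⟩ := exists_subformulaClosed_superset hfin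
  refine ⟨{ ctx := hS.toFinset
            formulas := hC.toFinset
            bound := 5 * weightSum hC.toFinset.val + (weightSum Γ + weightSum Δ)
            ctx_subset := ?_
            bot_mem := ?_
            closed := ?_
            le_bound := Nat.le_add_right _ _ }, ?_, ?_, ?_, ?_⟩
  · intro F hF
    exact hC.mem_toFinset.mpr (hsub (.inr (.inl (hS.mem_toFinset.mp hF))))
  · exact hC.mem_toFinset.mpr (hsub (.inl rfl))
  · rwa [hC.coe_toFinset]
  · exact hS.coe_toFinset.symm
  · exact fun F hF => hC.mem_toFinset.mpr (hsub (.inr (.inr (.inl hF))))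
  · exact fun F hF => hC.mem_toFinset.mpr (hsub (.inr (.inr (.inr hF))))
  · exact Nat.le_add_left _ _

end KPlus

theorem mainTheorem6 (S : Set KPlus.Formula) (Γ Δ : Multiset KPlus.Formula) (hS : S.Finite)
    (h : KPlus.ProvableWithCut ⟨S, Γ, Δ⟩) :
    ∃ π : KPlus.InfProof, π.Proves ⟨S, Γ, Δ⟩ ∧ π.CutFree ∧ π.Regular := by
  obtain ⟨σ, hσ⟩ := KPlus.SearchSpace.exists_of_sequent hS Γ Δ
  obtain ⟨n, hn⟩ := σ.exists_stage_eq
  have hfix : σ.IsFixed (σ.stage n) := fun A hA s hs => hn ▸ (⟨A, hA, hs⟩ : s ∈ σ.stage (n + 1))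
  obtain ⟨π, hπ⟩ := h
  have hmem := hfix.complete hσ fun W R V hRV w => π.sound hπ hRV w
  -- Passing to stage `n + 1` exposes the focus for the initial state.
  rw [← hn] at hmem
  obtain ⟨A, hA, hs⟩ := hmem
  exact σ.exists_regular (t₀ := ⟨n, A, ⟨S, Γ, Δ⟩⟩) ⟨hA, hs⟩
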